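/- Let $\mathbb S^2\subset\mathbb R^3$ be the unit sphere with its surface area measure. A sampling $\mathcal V$ of $\mathbb S^2$ with $n$ points consists of points $x_1,\dots,x_n\in\mathbb S^2$ and of corresponding measurable patches $\sigma_1,\dots,\sigma_n\subset\mathbb S^2$ that cover $\mathbb S^2$ and overlap pairwise only in sets of area zero. It is equi-area if all patches have the same area. Put $d_i=\sup_{z\in\sigma_i}\|x_i-z\|$ and $d^{(n)}=\max_{i}d_i$. For $t>0$ and $f:\mathbb S^2\to\mathbb R$ the scaled extended graph Laplacian of the sampling is $$\hat L_n^t f(y)=\frac{|\mathbb S^2|}{4\pi t^2}\,\frac1n\sum_{i=1}^n e^{-\frac{\|x_i-y\|^2}{4t}}\bigl(f(y)-f(x_i)\bigr),\qquad y\in\mathbb S^2,$$ where $|\mathbb S^2|$ is the area of the sphere, and the rotation operator of $g\in SO(3)$ is $R(g)f(x)=f(g^{-1}x)$. Theorem. Let $C\in\mathbb R$ and $\alpha\in(0,1/2]$. For each $n$ in a sequence of sizes tending to infinity (for instance all $n\ge1$), let an equi-area sampling of $\mathbb S^2$ with $n$ points be given such that $d^{(n)}\le C/n^{\alpha}$.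 Let $t_n=n^\beta$ with $-\frac{2\alpha}{5}<\beta<0$. Then for every $f:\mathbb S^2\to\mathbb R$ that is Lipschitz with respect to the Euclidean distance of $\mathbb R^3$, every $g\in SO(3)$ and every $y\in\mathbb S^2$, $$\bigl|R(g)\,\hat L_n^{t_n}f(y)-\hat L_n^{t_n}R(g)f(y)\bigr|\longrightarrow 0\qquad(n\to\infty).$$ -/

import Mathlib

open Filter Topology MeasureTheory

namespace SphereLaplacian

/-- Three-dimensional Euclidean space. -/
abbrev E3 : Type := EuclideanSpace ℝ (Fin 3)

/-- The unit sphere `S²` of `ℝ³`; its distance is the Euclidean distance of `ℝ³`. -/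
abbrev S2 : Type := Metric.sphere (0 : E3) 1

/-- The rotation group `SO(3)`. -/
abbrev SO3 : Type := Matrix.specialOrthogonalGroup (Fin 3) ℝ

/-- The surface area measure of the unit sphere. -/
noncomputable def area : Measure S2 := (volume : Measure E3).toSphere

/-- A sampling of the sphere by `n` points, together with the patches of the surface that
correspond to them: measurable sets that cover the sphere and overlap only in sets of
area zero. -/
structure Sampling (n : ℕ) where
  /-- the sampling points `x_i` -/
  point : Fin n → S2
  /-- the patches `σ_i` -/
  patch : Fin n → Set S2
  measurableSet_patch : ∀ i, MeasurableSet (patch i)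
  iUnion_patch : ⋃ i, patch i = Set.univ
  aedisjoint_patch : ∀ i j, i ≠ j → AEDisjoint area (patch i) (patch j)

/-- All patches have the same area, `A_i = A_j`. -/
def Sampling.IsEquiArea {n : ℕ} (V : Sampling n) : Prop :=
  ∀ i j, area (V.patch i) = area (V.patch j)

/-- `d_i`, the largest distance between `x_i` and any point of its patch `σ_i`. -/
noncomputable def Sampling.radius {n : ℕ} (V : Sampling n) (i : Fin n) : ℝ :=
  sSup ((fun z : S2 => dist (V.point i) z) '' V.patch i)

/-- `d^(n)`, the maximum of the `d_i`. -/
noncomputable def Sampling.maxRadius {n : ℕ} (V : Sampling n) : ℝ :=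
  ⨆ i, V.radius i

/-- The extended graph Laplacian
`L_n^t f(y) = (1/n) ∑_i exp(-‖x_i - y‖² / (4t)) (f(y) - f(x_i))`. -/
noncomputable def Sampling.extLaplacian {n : ℕ} (V : Sampling n) (t : ℝ) (f : S2 → ℝ) :
    S2 → ℝ := fun y =>
  (1 / (n : ℝ)) *
    ∑ i, Real.exp (-(‖(V.point i : E3) - (y : E3)‖ ^ 2 / (4 * t))) * (f y - f (V.point i))

/-- The scaled extended graph Laplacian `|S²| (4πt²)⁻¹ L_n^t`. -/
noncomputable def Sampling.scaledLaplacian {n : ℕ} (V : Sampling n) (t : ℝ) (f : S2 → ℝ) :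
    S2 → ℝ := fun y =>
  area.real Set.univ * (4 * Real.pi * t ^ 2)⁻¹ * V.extLaplacian t f y

theorem norm_rotate (g : SO3) (v : E3) :
    ‖(WithLp.toLp 2 (Matrix.mulVec (g : Matrix (Fin 3) (Fin 3) ℝ) (WithLp.ofLp v)) : E3)‖
      = ‖v‖ := by
  have hg : (g : Matrix (Fin 3) (Fin 3) ℝ).transpose * (g : Matrix (Fin 3) (Fin 3) ℝ) = 1 :=
    (Matrix.mem_orthogonalGroup_iff' (Fin 3) ℝ).1
      (Matrix.mem_specialOrthogonalGroup_iff.1 g.2).1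
  have h : ∀ w : Fin 3 → ℝ, ‖(WithLp.toLp 2 w : E3)‖ ^ 2 = w ⬝ᵥ w := by
    intro w
    rw [EuclideanSpace.real_norm_sq_eq]
    simp [dotProduct, pow_two]
  have h2 : ‖(WithLp.toLp 2 (Matrix.mulVec (g : Matrix (Fin 3) (Fin 3) ℝ)
      (WithLp.ofLp v)) : E3)‖ ^ 2 = ‖v‖ ^ 2 := by
    have hv := h (WithLp.ofLp v)
    rw [WithLp.toLp_ofLp] at hv
    rw [h, hv, Matrix.dotProduct_mulVec, ← Matrix.mulVec_transpose, Matrix.mulVec_mulVec, hg,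
      Matrix.one_mulVec]
  exact (sq_eq_sq₀ (norm_nonneg _) (norm_nonneg _)).1 h2

/-- The image `g y` of a point of the sphere under a rotation. -/
noncomputable def rotate (g : SO3) (y : S2) : S2 :=
  ⟨WithLp.toLp 2 (Matrix.mulVec (g : Matrix (Fin 3) (Fin 3) ℝ) (WithLp.ofLp (y : E3))), by
    rw [mem_sphere_zero_iff_norm, norm_rotate]
    exact mem_sphere_zero_iff_norm.1 y.2⟩

/-- The rotation operator `R(g) f(x) = f(g⁻¹ x)` on functions on the sphere. -/
noncomputable def rotOp (g : SO3) (f : S2 → ℝ) : S2 → ℝ := fun x => f (rotate g⁻¹ x)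

end SphereLaplacian

/-! The graph Laplacian is a quadrature rule for the integral operator `heatLaplacian`, which
commutes exactly with rotations because area and Euclidean distance are invariant. The commutator is
thus a difference of two quadrature errors: for `f` at `g⁻¹ y` and for `R(g) f` at `y`. Equal areas
make each weight `|S²|/n` the area of a patch, so an error is at most Lipschitz constant times
`maxRadius` times `|S²|`. The integrand has Lipschitz constant `O(t^(-1/2))` for small `t` and the
prefactor is of order `t⁻²`, giving `O(n^(-(α + 5β/2)))`; the exponent is negative because `β >
-2α/5`. -/

namespace SphereLaplacian

open scoped Pointwise

/-- The linear isometry of `ℝ³` given by a rotation matrix. -/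
noncomputable def rotationIsometry (g : SO3) : E3 ≃ₗᵢ[ℝ] E3 :=
  LinearIsometry.toLinearIsometryEquiv
    { toLinearMap := Matrix.toLpLin 2 2 (g : Matrix (Fin 3) (Fin 3) ℝ)
      norm_map' := fun v => norm_rotate g v } rfl

theorem coe_rotate (g : SO3) (y : S2) : (rotate g y : E3) = rotationIsometry g (y : E3) := rfl

theorem isometry_rotate (g : SO3) : Isometry (rotate g) :=
  Isometry.of_dist_eq fun x y => by
    rw [Subtype.dist_eq, coe_rotate, coe_rotate, LinearIsometryEquiv.dist_map, Subtype.dist_eq]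

theorem rotate_mul (g h : SO3) (y : S2) : rotate (g * h) y = rotate g (rotate h y) := by
  apply Subtype.ext
  simp [rotate, Matrix.mulVec_mulVec]

theorem rotate_one (y : S2) : rotate 1 y = y := by
  apply Subtype.ext
  simp [rotate]

theorem rotate_inv_rotate (g : SO3) (y : S2) : rotate g⁻¹ (rotate g y) = y := by
  rw [← rotate_mul, inv_mul_cancel, rotate_one]

theorem rotate_rotate_inv (g : SO3) (y : S2) : rotate g (rotate g⁻¹ y) = y := by
  rw [← rotate_mul, mul_inv_cancel, rotate_one]

/-- `toSphere` measures a set through the volume of the cone over it, and a linear isometry maps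
cones to cones and preserves volume. -/
theorem measurePreserving_rotate (g : SO3) : MeasurePreserving (rotate g) area area := by
  have hm : Measurable (rotate g) := (isometry_rotate g).continuous.measurable
  refine ⟨hm, Measure.ext fun s hs => ?_⟩
  rw [Measure.map_apply hm hs, area, Measure.toSphere_apply' _ hs,
    Measure.toSphere_apply' _ (hm hs)]
  congr 1
  symm
  rw [← (rotationIsometry g).measurePreserving.measure_preimage_equiv
    (f := (rotationIsometry g).toHomeomorph.toMeasurableEquiv)]
  congr 1
  ext v
  simp only [Set.mem_preimage, Set.mem_smul, Set.mem_image]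
  constructor
  · rintro ⟨r, hr, _, ⟨x, hx, rfl⟩, hv⟩
    refine ⟨r, hr, _, ⟨rotate g⁻¹ x, by simpa [rotate_rotate_inv] using hx, rfl⟩, ?_⟩
    apply (rotationIsometry g).injective
    rw [map_smul, ← coe_rotate, rotate_rotate_inv]
    exact hv
  · rintro ⟨r, hr, _, ⟨x, hx, rfl⟩, rfl⟩
    exact ⟨r, hr, _, ⟨rotate g x, hx, rfl⟩, ((rotationIsometry g).map_smul r (x : E3)).symm⟩

instance : IsFiniteMeasure area := by unfold area; infer_instance

theorem abs_exp_neg_sq_sub_le (a b : ℝ) :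
    |Real.exp (-a ^ 2) - Real.exp (-b ^ 2)| ≤ 2 * |a - b| := by
  have hderiv : ∀ x ∈ (Set.univ : Set ℝ),
      HasDerivWithinAt (fun x : ℝ => Real.exp (-x ^ 2))
        (Real.exp (-x ^ 2) * (-(2 * x))) Set.univ x := by
    intro x _
    have := ((hasDerivAt_pow 2 x).neg).exp
    simpa using this.hasDerivWithinAt (s := Set.univ)
  refine convex_univ.norm_image_sub_le_of_norm_hasDerivWithin_le hderiv (fun x _ => ?_)
    (Set.mem_univ b) (Set.mem_univ a)
  rw [Real.norm_eq_abs, abs_mul, Real.abs_exp, abs_neg, abs_mul, abs_two, Real.exp_neg,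
    inv_mul_le_iff₀ (Real.exp_pos _)]
  -- `2|x| ≤ 1 + x² ≤ exp (x²)`.
  nlinarith [Real.add_one_le_exp (x ^ 2), sq_abs x, sq_nonneg (|x| - 1)]

/-- The integrand of the heat kernel Laplacian at `y`. -/
noncomputable def heatIntegrand (t : ℝ) (f : S2 → ℝ) (y x : S2) : ℝ :=
  Real.exp (-(‖(x : E3) - (y : E3)‖ ^ 2 / (4 * t))) * (f y - f x)

theorem dist_le_two (x y : S2) : dist x y ≤ 2 := by
  rw [Subtype.dist_eq]
  calc dist (x : E3) y ≤ ‖(x : E3)‖ + ‖(y : E3)‖ := dist_le_norm_add_norm _ _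
    _ = 2 := by rw [norm_eq_of_mem_sphere, norm_eq_of_mem_sphere]; norm_num

/-- Product rule: the variation of `f` costs `K` since the Gaussian is at most 1; that of the
Gaussian, of rate at most `1/√t`, is multiplied by `|f y - f z| ≤ 2K`, the sphere having diameter 2.
-/
theorem abs_heatIntegrand_sub_le {t : ℝ} (ht : 0 < t) {K : NNReal} {f : S2 → ℝ}
    (hf : LipschitzWith K f) (y x z : S2) :
    |heatIntegrand t f y x - heatIntegrand t f y z| ≤ K * (1 + 2 / √t) * dist x z := by
  have hexp (w : S2) : Real.exp (-(‖(w : E3) - (y : E3)‖ ^ 2 / (4 * t)))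
      = Real.exp (-(dist w y / (2 * √t)) ^ 2) := by
    rw [div_pow, mul_pow, Real.sq_sqrt ht.le, Subtype.dist_eq, dist_eq_norm]
    norm_num
  have hst : 0 < √t := Real.sqrt_pos.2 ht
  set a := dist x y / (2 * √t)
  set b := dist z y / (2 * √t)
  have hab : |a - b| ≤ dist x z / (2 * √t) := by
    rw [← sub_div, abs_div, abs_of_pos (by positivity : 0 < 2 * √t)]
    gcongr
    exact abs_dist_sub_le x z y
  have h1 : |f z - f x| ≤ K * dist x z := by
    rw [dist_comm x z]
    exact hf.dist_le_mul z x
  have h2 : |f y - f z| ≤ K * 2 := by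
    refine (hf.dist_le_mul y z).trans ?_
    gcongr
    exact dist_le_two y z
  have h3 : Real.exp (-a ^ 2) ≤ 1 := Real.exp_le_one_iff.2 (by nlinarith [sq_nonneg a])
  unfold heatIntegrand
  rw [hexp, hexp]
  calc |Real.exp (-a ^ 2) * (f y - f x) - Real.exp (-b ^ 2) * (f y - f z)|
      = |Real.exp (-a ^ 2) * (f z - f x)
          + (Real.exp (-a ^ 2) - Real.exp (-b ^ 2)) * (f y - f z)| := by ring_nf
    _ ≤ Real.exp (-a ^ 2) * |f z - f x|
          + |Real.exp (-a ^ 2) - Real.exp (-b ^ 2)| * |f y - f z| := by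
        refine (abs_add_le _ _).trans_eq ?_
        rw [abs_mul, abs_mul, Real.abs_exp]
    _ ≤ 1 * (K * dist x z) + (2 * (dist x z / (2 * √t))) * (K * 2) := by
        gcongr
        exact (abs_exp_neg_sq_sub_le a b).trans (by gcongr)
    _ = K * (1 + 2 / √t) * dist x z := by field_simp

theorem continuous_heatIntegrand {t : ℝ} {f : S2 → ℝ} (hf : Continuous f) (y : S2) :
    Continuous (heatIntegrand t f y) := by
  unfold heatIntegrand
  fun_prop

theorem Sampling.dist_le_maxRadius {n : ℕ} (V : Sampling n) (i : Fin n) {z : S2}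
    (hz : z ∈ V.patch i) : dist (V.point i) z ≤ V.maxRadius := by
  have h1 : dist (V.point i) z ≤ V.radius i :=
    le_csSup ⟨2, by rintro _ ⟨w, _, rfl⟩; exact dist_le_two _ _⟩ ⟨z, hz, rfl⟩
  exact h1.trans (le_ciSup (Set.finite_range V.radius).bddAbove i)

theorem Sampling.sum_area_patch {n : ℕ} (V : Sampling n) :
    ∑ i, area.real (V.patch i) = area.real Set.univ := by
  have h := measure_iUnion₀ (μ := area) (f := V.patch)
    (fun i j hij => V.aedisjoint_patch i j hij)
    (fun i => (V.measurableSet_patch i).nullMeasurableSet)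
  rw [V.iUnion_patch, tsum_fintype] at h
  rw [measureReal_def, h, ENNReal.toReal_sum fun i _ => measure_ne_top _ _]
  rfl

theorem Sampling.IsEquiArea.area_real_patch {n : ℕ} {V : Sampling n} (hV : V.IsEquiArea)
    (i : Fin n) : area.real (V.patch i) = area.real Set.univ * (1 / n) := by
  have hn : (n : ℝ) ≠ 0 := by have := i.pos; positivity
  have h := V.sum_area_patch
  rw [Finset.sum_congr rfl fun j _ =>
    show area.real (V.patch j) = area.real (V.patch i) by
      rw [measureReal_def, measureReal_def, hV j i]] at h
  simp at h
  rw [← h]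
  field_simp

theorem Sampling.integral_eq_sum {n : ℕ} (V : Sampling n) {h : S2 → ℝ} (hh : Integrable h area) :
    ∫ x, h x ∂area = ∑ i, ∫ x in V.patch i, h x ∂area := by
  have := integral_iUnion_ae (μ := area) (f := h)
    (fun i => (V.measurableSet_patch i).nullMeasurableSet)
    (fun i j hij => V.aedisjoint_patch i j hij) hh.integrableOn
  rwa [V.iUnion_patch, setIntegral_univ, tsum_fintype] at this

/-- The quadrature error of an equi-area sampling on a Lipschitz function. -/
theorem Sampling.IsEquiArea.abs_quadrature_sub_integral_le {n : ℕ} {V : Sampling n}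
    (hV : V.IsEquiArea) {h : S2 → ℝ} (hh : Integrable h area) {M : ℝ} (hM : 0 ≤ M)
    (hlip : ∀ x z, |h x - h z| ≤ M * dist x z) :
    |area.real Set.univ * ((1 / n) * ∑ i, h (V.point i)) - ∫ x, h x ∂area|
      ≤ M * V.maxRadius * area.real Set.univ := by
  -- The quadrature sum is the integral of the step function equal to `h (x_i)` on `σ_i`.
  have hsum : area.real Set.univ * ((1 / n) * ∑ i, h (V.point i))
      = ∑ i, ∫ _ in V.patch i, h (V.point i) ∂area := by
    rw [← mul_assoc, Finset.mul_sum]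
    refine Finset.sum_congr rfl fun i _ => ?_
    rw [setIntegral_const, smul_eq_mul, hV.area_real_patch]
  rw [hsum, V.integral_eq_sum hh, ← Finset.sum_sub_distrib]
  calc |∑ i, (∫ _ in V.patch i, h (V.point i) ∂area - ∫ x in V.patch i, h x ∂area)|
      ≤ ∑ i, |∫ _ in V.patch i, h (V.point i) ∂area - ∫ x in V.patch i, h x ∂area| :=
        Finset.abs_sum_le_sum_abs _ _
    _ ≤ ∑ i, M * V.maxRadius * area.real (V.patch i) := by
        refine Finset.sum_le_sum fun i _ => ?_
        rw [← integral_sub (integrable_const (μ := area.restrict (V.patch i)) _) hh.integrableOn,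
          ← Real.norm_eq_abs]
        refine norm_setIntegral_le_of_norm_le_const (measure_lt_top area _) fun x hx => ?_
        exact (hlip _ _).trans (mul_le_mul_of_nonneg_left (V.dist_le_maxRadius i hx) hM)
    _ = M * V.maxRadius * area.real Set.univ := by rw [← Finset.mul_sum, V.sum_area_patch]

/-- The scaled heat kernel Laplacian, the continuous counterpart of `Sampling.scaledLaplacian`. -/
noncomputable def heatLaplacian (t : ℝ) (f : S2 → ℝ) (y : S2) : ℝ :=
  (4 * Real.pi * t ^ 2)⁻¹ * ∫ x, heatIntegrand t f y x ∂area

/-- Substitute `x ↦ g⁻¹ x`; the kernel depends only on the distance. -/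
theorem heatLaplacian_rotOp (t : ℝ) (f : S2 → ℝ) (g : SO3) (y : S2) :
    heatLaplacian t (rotOp g f) y = rotOp g (heatLaplacian t f) y := by
  have hemb : MeasurableEmbedding (rotate g⁻¹) :=
    (isometry_rotate g⁻¹).isClosedEmbedding.measurableEmbedding
  unfold rotOp heatLaplacian
  rw [← (measurePreserving_rotate g⁻¹).integral_comp hemb (heatIntegrand t f (rotate g⁻¹ y))]
  congr 2
  ext x
  unfold heatIntegrand
  rw [coe_rotate, coe_rotate, ← map_sub, LinearIsometryEquiv.norm_map]

theorem Sampling.IsEquiArea.abs_scaledLaplacian_sub_heatLaplacian_le {n : ℕ} {V : Sampling n}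
    (hV : V.IsEquiArea) {t : ℝ} (ht : 0 < t) {K : NNReal} {f : S2 → ℝ}
    (hf : LipschitzWith K f) (y : S2) :
    |V.scaledLaplacian t f y - heatLaplacian t f y|
      ≤ (4 * Real.pi * t ^ 2)⁻¹ *
        (K * (1 + 2 / √t) * V.maxRadius * area.real Set.univ) := by
  have hint : Integrable (heatIntegrand t f y) area :=
    (continuous_heatIntegrand hf.continuous y).integrable_of_hasCompactSupport
      (HasCompactSupport.of_compactSpace _)
  have h := hV.abs_quadrature_sub_integral_le hint (by positivity)
    (abs_heatIntegrand_sub_le ht hf y)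
  have heq : V.scaledLaplacian t f y - heatLaplacian t f y
      = (4 * Real.pi * t ^ 2)⁻¹ * (area.real Set.univ *
        ((1 / n) * ∑ i, heatIntegrand t f y (V.point i)) - ∫ x, heatIntegrand t f y x ∂area) := by
    simp only [Sampling.scaledLaplacian, Sampling.extLaplacian, heatLaplacian, heatIntegrand]
    ring
  rw [heq, abs_mul, abs_of_nonneg (by positivity : 0 ≤ (4 * Real.pi * t ^ 2)⁻¹)]
  gcongr

theorem lipschitzWith_rotOp {K : NNReal} {f : S2 → ℝ} (hf : LipschitzWith K f) (g : SO3) :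
    LipschitzWith K (rotOp g f) := by
  have h := hf.comp (isometry_rotate g⁻¹).lipschitz
  rwa [mul_one] at h

/-- Along a sequence of equi-area samplings, the scaled graph Laplacian converges to the
scaled heat kernel Laplacian. -/
theorem tendsto_scaledLaplacian_sub_heatLaplacian {α C : ℝ}
    {N : ℕ → ℕ} (hN : Tendsto N atTop atTop) {V : (k : ℕ) → Sampling (N k)}
    (hV : ∀ k, (V k).IsEquiArea) (hd : ∀ k, (V k).maxRadius ≤ C / (N k : ℝ) ^ α)
    {β : ℝ} (hβ : -(2 * α / 5) < β) (hβ' : β < 0) {K : NNReal} {f : S2 → ℝ}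
    (hf : LipschitzWith K f) (y : S2) :
    Tendsto (fun k => (V k).scaledLaplacian ((N k : ℝ) ^ β) f y
      - heatLaplacian ((N k : ℝ) ^ β) f y) atTop (𝓝 0) := by
  have hcast : Tendsto (fun k => (N k : ℝ)) atTop atTop :=
    tendsto_natCast_atTop_atTop.comp hN
  have hlim : Tendsto (fun k => (4 * Real.pi)⁻¹ * (K * 3 * C * area.real Set.univ) *
      (N k : ℝ) ^ (-(α + 5 / 2 * β))) atTop (𝓝 0) := by
    simpa using ((tendsto_rpow_neg_atTop (by linarith : 0 < α + 5 / 2 * β)).comp hcast).const_mul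
      ((4 * Real.pi)⁻¹ * (K * 3 * C * area.real Set.univ))
  refine squeeze_zero_norm' ?_ hlim
  filter_upwards [hcast.eventually_ge_atTop 1] with k hk
  have hpos : (0 : ℝ) < N k := one_pos.trans_le hk
  have ht : 0 < (N k : ℝ) ^ β := Real.rpow_pos_of_pos hpos _
  refine ((hV k).abs_scaledLaplacian_sub_heatLaplacian_le ht hf y).trans ?_
  have hs : √((N k : ℝ) ^ β) = (N k : ℝ) ^ (β / 2) := by
    rw [Real.sqrt_eq_rpow, ← Real.rpow_mul hpos.le]
    ring_nf
  -- As `β < 0`, `√t ≤ 1`, so `1 + 2/√t ≤ 3/√t`.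
  have hs1 : (1 : ℝ) ≤ 1 / (N k : ℝ) ^ (β / 2) := by
    rw [one_le_div (Real.rpow_pos_of_pos hpos _)]
    exact Real.rpow_le_one_of_one_le_of_nonpos hk (by linarith)
  -- The sign of `C` is not assumed; it is forced by `maxRadius ≥ 0`.
  have hC : 0 ≤ C / (N k : ℝ) ^ α := by
    refine le_trans ?_ (hd k)
    have : Nonempty (Fin (N k)) := ⟨⟨0, by exact_mod_cast hpos⟩⟩
    exact Real.iSup_nonneg fun i => Real.sSup_nonneg (by rintro _ ⟨z, _, rfl⟩; exact dist_nonneg)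
  have hpow : (N k : ℝ) ^ (-(α + 5 / 2 * β))
      = (((N k : ℝ) ^ β) ^ 2)⁻¹ * ((1 / (N k : ℝ) ^ (β / 2)) * (1 / (N k : ℝ) ^ α)) := by
    rw [one_div, one_div, ← Real.rpow_natCast, ← Real.rpow_mul hpos.le, ← Real.rpow_neg hpos.le,
      ← Real.rpow_neg hpos.le, ← Real.rpow_neg hpos.le, ← Real.rpow_add hpos,
      ← Real.rpow_add hpos]
    congr 1
    push_cast
    ring
  rw [hs]
  calc (4 * Real.pi * ((N k : ℝ) ^ β) ^ 2)⁻¹ *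
        (K * (1 + 2 / (N k : ℝ) ^ (β / 2)) * (V k).maxRadius * area.real Set.univ)
      ≤ (4 * Real.pi * ((N k : ℝ) ^ β) ^ 2)⁻¹ *
        (K * (3 * (1 / (N k : ℝ) ^ (β / 2))) * (C / (N k : ℝ) ^ α) * area.real Set.univ) := by
        have h3 : 1 + 2 / (N k : ℝ) ^ (β / 2) ≤ 3 * (1 / (N k : ℝ) ^ (β / 2)) := by
          rw [← mul_one_div 2]
          linarith
        refine mul_le_mul_of_nonneg_left (mul_le_mul_of_nonneg_right ?_ measureReal_nonneg)
          (by positivity)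
        exact (mul_le_mul_of_nonneg_left (hd k) (by positivity)).trans
          (mul_le_mul_of_nonneg_right (mul_le_mul_of_nonneg_left h3 K.2) hC)
    _ = (4 * Real.pi)⁻¹ * (K * 3 * C * area.real Set.univ) *
          (N k : ℝ) ^ (-(α + 5 / 2 * β)) := by
        rw [hpow, mul_inv]
        ring

end SphereLaplacian

theorem theorem2
    (α C : ℝ) (hα : 0 < α) (hα' : α ≤ 1 / 2)
    (N : ℕ → ℕ) (hN : Tendsto N atTop atTop)
    (V : (k : ℕ) → SphereLaplacian.Sampling (N k))
    (hV : ∀ k, (V k).IsEquiArea)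
    (hd : ∀ k, (V k).maxRadius ≤ C / (N k : ℝ) ^ α)
    (β : ℝ) (hβ : -(2 * α / 5) < β) (hβ' : β < 0)
    (f : SphereLaplacian.S2 → ℝ) (hf : ∃ K, LipschitzWith K f)
    (g : SphereLaplacian.SO3) (y : SphereLaplacian.S2) :
    Tendsto
      (fun k =>
        |SphereLaplacian.rotOp g ((V k).scaledLaplacian ((N k : ℝ) ^ β) f) y
          - (V k).scaledLaplacian ((N k : ℝ) ^ β) (SphereLaplacian.rotOp g f) y|)
      atTop (𝓝 0) := by
  obtain ⟨K, hK⟩ := hf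
  have h1 := SphereLaplacian.tendsto_scaledLaplacian_sub_heatLaplacian hN hV hd hβ hβ' hK
    (SphereLaplacian.rotate g⁻¹ y)
  have h2 := SphereLaplacian.tendsto_scaledLaplacian_sub_heatLaplacian hN hV hd hβ hβ'
    (SphereLaplacian.lipschitzWith_rotOp hK g) y
  have h3 := (h1.sub h2).abs
  simp only [sub_zero, abs_zero] at h3
  refine h3.congr fun k => ?_
  -- The two heat terms now coincide and cancel.
  rw [SphereLaplacian.heatLaplacian_rotOp]
  unfold SphereLaplacian.rotOp
  congr 1
  ring
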